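/- For a finite connected graph $G$ with distance function $d_G$ and eccentricities $e_G(v)=\max_{u}d_G(v,u)$, let $\mathcal{E}(G)$ be the eccentricity matrix of $G$, that is, the real symmetric matrix indexed by the vertices of $G$ with $$\mathcal{E}(G)_{uv}=\begin{cases} d_G(u,v) & \text{if } d_G(u,v)=\min\{e_G(u),e_G(v)\},\\ 0 & \text{otherwise,}\end{cases}$$ and let $\xi_1(G)$ (the $\mathcal{E}$-spectral radius of $G$) be its largest eigenvalue. Let $G^c$ denote the complement of $G$ and $P_n$ the path on $n$ vertices. **Theorem.** Let $T$ be a tree of order $n\ge 4$ whose complement $T^c$ is connected. Then $$\xi_1(T^c)\ \ge\ \xi_1(P_n^c),$$ with equality if and only if $T\cong P_n$. Here $P_n^c$ is connected, $\xi_1(P_n^c)=4\cos\frac{\pi}{n+1}$ for $n\ge 5$, and $\xi_1(P_4^c)=4$. -/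

import Mathlib

namespace SimpleGraph

open Classical in
/-- The eccentricity matrix of a graph `G`: the `(u, v)` entry is the distance `d(u, v)` if
`d(u, v) = min {e(u), e(v)}`, where `e` is the eccentricity, and `0` otherwise. The comparison is
made between the extended distance and the extended eccentricities; for a connected finite graph
these are the usual natural numbers. -/
noncomputable def eccMatrix {V : Type*} (G : SimpleGraph V) : Matrix V V ℝ :=
  Matrix.of fun u v =>
    if G.edist u v = min (G.eccent u) (G.eccent v) then (G.dist u v : ℝ) else 0

theorem eccMatrix_isHermitian {V : Type*} (G : SimpleGraph V) : G.eccMatrix.IsHermitian := by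
  ext u v
  simp [eccMatrix, Matrix.conjTranspose_apply, edist_comm, dist_comm, min_comm]

/-- The largest eigenvalue of the (real symmetric) eccentricity matrix of `G`. -/
noncomputable def eccSpectralRadius {V : Type*} [Fintype V] [DecidableEq V]
    (G : SimpleGraph V) : ℝ :=
  sSup (spectrum ℝ G.eccMatrix)

/-- The supremum in `eccSpectralRadius` is a maximum: it is itself an eigenvalue. -/
theorem isGreatest_eccSpectralRadius {V : Type*} [Fintype V] [DecidableEq V] [Nonempty V]
    (G : SimpleGraph V) : IsGreatest (spectrum ℝ G.eccMatrix) G.eccSpectralRadius := by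
  have hfin : (spectrum ℝ G.eccMatrix).Finite := Matrix.finite_real_spectrum
  have hne : (spectrum ℝ G.eccMatrix).Nonempty :=
    ⟨_, G.eccMatrix_isHermitian.eigenvalues_mem_spectrum_real (Classical.arbitrary V)⟩
  exact ⟨hne.csSup_mem hfin, fun _ hx => le_csSup hfin.bddAbove hx⟩

end SimpleGraph

/-! A tree has no triangle and no four-cycle, and connectedness of its complement excludes a
universal vertex. Hence `eccMatrix_compl_apply`: the eccentricity matrix of the complement lives on
the edges of `T`, with entry 3 on dominating edges and 2 elsewhere. For `n ≥ 5` the path has no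
dominating edge, so its matrix is twice the adjacency matrix, with positive sine eigenvector.

The lower bound is a rearrangement argument. `Connected.exists_numbering` numbers the vertices `0,
…, n - 1` so that each `v` other than the first has a neighbour `p v` numbered at most `σ v - 2`
(truncated). In the path numbered from the middle outwards, this bound is an equality. Placing the
path's eigenvector on `T` in decreasing order along `σ` makes each product `x v * x (p v)` at least
the corresponding product for the path, so the Rayleigh quotient is at least `4 cos (π / (n + 1))`.

In case of equality the test vector is an eigenvector. Comparing rows forces `σ (p v) = σ v - 2`
throughout, so `T` contains a spanning path and equals it. For `n = 4` the middle edge of the path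
is dominating and the bound is not sharp, but the path is the only tree allowed. -/

namespace SimpleGraph

/-! ### Distances and eccentricities in the complement of a sparse graph -/

theorem IsAcyclic.eq_of_adj_of_adj {V : Type*} {G : SimpleGraph V} (h : G.IsAcyclic)
    {u v a b : V} (hua : G.Adj u a) (hav : G.Adj a v) (hub : G.Adj u b) (hbv : G.Adj b v)
    (huv : u ≠ v) : a = b := by
  have h1 : (Walk.cons hua (Walk.cons hav Walk.nil)).IsPath := by
    simp [Walk.cons_isPath_iff, hua.ne, hav.ne, huv]
  have h2 : (Walk.cons hub (Walk.cons hbv Walk.nil)).IsPath := by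
    simp [Walk.cons_isPath_iff, hub.ne, hbv.ne, huv]
  have := congrArg (fun p : G.Path u v => p.1.snd) ((h.subsingleton_path u v).elim ⟨_, h1⟩ ⟨_, h2⟩)
  simpa using this

theorem IsAcyclic.not_adj_of_adj_of_adj {V : Type*} {G : SimpleGraph V} (h : G.IsAcyclic)
    {u v w : V} (huw : G.Adj u w) (hwv : G.Adj w v) : ¬ G.Adj u v := by
  intro huv
  have h1 : (Walk.cons huw (Walk.cons hwv Walk.nil)).IsPath := by
    simp [Walk.cons_isPath_iff, huw.ne, hwv.ne, huv.ne]
  have h2 : (Walk.cons huv Walk.nil).IsPath := by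
    simp [Walk.cons_isPath_iff, huv.ne]
  have := congrArg (fun p : G.Path u v => p.1.snd) ((h.subsingleton_path u v).elim ⟨_, h1⟩ ⟨_, h2⟩)
  exact hwv.ne (by simpa using this)

/-- The graphs whose complements have an explicit eccentricity matrix here: no isolated vertex,
no universal vertex, no triangle and no four-cycle. -/
structure IsSparse {V : Type*} (G : SimpleGraph V) : Prop where
  exists_adj : ∀ u, ∃ v, G.Adj u v
  exists_compl_adj : ∀ u, ∃ v, Gᶜ.Adj u v
  not_adj : ∀ {u w v}, G.Adj u w → G.Adj w v → ¬ G.Adj u v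
  eq_of_adj : ∀ {u a v b}, G.Adj u a → G.Adj a v → G.Adj u b → G.Adj b v → u ≠ v → a = b

theorem IsTree.isSparse {V : Type*} [Nontrivial V] {T : SimpleGraph V} (hT : T.IsTree)
    (hTc : Tᶜ.Connected) : T.IsSparse where
  exists_adj u := hT.connected.preconnected.exists_adj_of_nontrivial u
  exists_compl_adj u := hTc.preconnected.exists_adj_of_nontrivial u
  not_adj h1 h2 := hT.isAcyclic.not_adj_of_adj_of_adj h1 h2
  eq_of_adj h1 h2 h3 h4 h := hT.isAcyclic.eq_of_adj_of_adj h1 h2 h3 h4 h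

namespace IsSparse

variable {V : Type*} {G : SimpleGraph V}

theorem edist_compl_eq_two {u v : V} (huv : G.Adj u v)
    (hz : ¬ ∀ z, G.Adj z u ∨ G.Adj z v) : Gᶜ.edist u v = 2 := by
  push Not at hz
  obtain ⟨z, hzu, hzv⟩ := hz
  refine edist_eq_two_iff.2 ⟨huv.ne, by simp [huv], z, ?_⟩
  have h1 : z ≠ u := by rintro rfl; exact hzv huv
  have h2 : z ≠ v := by rintro rfl; exact hzu huv.symm
  simp [mem_commonNeighbors, compl_adj, h1.symm, h2.symm, G.adj_comm u, G.adj_comm v, hzu, hzv]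

theorem edist_compl_eq_three (h : G.IsSparse) {u v : V} (huv : G.Adj u v)
    (hz : ∀ z, G.Adj z u ∨ G.Adj z v) : Gᶜ.edist u v = 3 := by
  apply le_antisymm
  -- Domination makes the non-neighbour `a` of `u` adjacent to `v`, and the non-neighbour `b` of `v`
  -- adjacent to `u`. An edge `ab` would close a four-cycle, so `u, a, b, v` is a walk in the
  -- complement.
  · obtain ⟨a, ha⟩ := h.exists_compl_adj u
    obtain ⟨b, hb⟩ := h.exists_compl_adj v
    rw [compl_adj] at ha hb
    have hav : G.Adj a v := (hz a).resolve_left fun h' => ha.2 h'.symm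
    have hbu : G.Adj b u := (hz b).resolve_right fun h' => hb.2 h'.symm
    have hab : Gᶜ.Adj a b := by
      rw [compl_adj]
      refine ⟨?_, fun hab => ?_⟩
      · rintro rfl; exact ha.2 hbu.symm
      · exact hb.1 (h.eq_of_adj hbu.symm hab.symm huv hav.symm ha.1).symm
    have h1 : Gᶜ.Adj u a := by simpa [compl_adj] using ha
    have h2 : Gᶜ.Adj b v := by simpa [compl_adj] using ⟨hb.1.symm, fun h' => hb.2 h'.symm⟩
    exact edist_le (Walk.cons h1 (Walk.cons hab (Walk.cons h2 Walk.nil)))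
  · have : 2 < Gᶜ.edist u v := by
      refine two_lt_edist_iff.2 ⟨huv.ne, by simp [huv], ?_⟩
      ext z
      simp only [mem_commonNeighbors, compl_adj, Set.mem_empty_iff_false, iff_false]
      rintro ⟨⟨-, h1⟩, -, h2⟩
      exact (hz z).elim (fun h' => h1 h'.symm) fun h' => h2 h'.symm
    exact Order.add_one_le_of_lt this

theorem edist_compl_le_one {u v : V} (huv : ¬ G.Adj u v) : Gᶜ.edist u v ≤ 1 := by
  rw [edist_le_one_iff_adj_or_eq, compl_adj]
  tauto

theorem edist_compl_le_three (h : G.IsSparse) (u v : V) : Gᶜ.edist u v ≤ 3 := by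
  by_cases huv : G.Adj u v
  · by_cases hz : ∀ z, G.Adj z u ∨ G.Adj z v
    · exact (h.edist_compl_eq_three huv hz).le
    · exact (edist_compl_eq_two huv hz).trans_le (by norm_num)
  · exact (edist_compl_le_one huv).trans (by norm_num)

theorem compl_connected [Nonempty V] (h : G.IsSparse) : Gᶜ.Connected :=
  ⟨fun u v => reachable_of_edist_ne_top fun h' => by
    have := h.edist_compl_le_three u v
    rw [h'] at this
    exact absurd this (by decide)⟩

theorem two_le_edist_compl (h : G.IsSparse) {u v : V} (huv : G.Adj u v) : 2 ≤ Gᶜ.edist u v := by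
  by_cases hz : ∀ z, G.Adj z u ∨ G.Adj z v
  · exact (h.edist_compl_eq_three huv hz) ▸ (by norm_num)
  · exact (edist_compl_eq_two huv hz).ge

theorem two_le_eccent_compl (h : G.IsSparse) (u : V) : 2 ≤ Gᶜ.eccent u := by
  obtain ⟨v, hv⟩ := h.exists_adj u
  exact (h.two_le_edist_compl hv).trans edist_le_eccent

theorem eccent_compl_le_three (h : G.IsSparse) (u : V) : Gᶜ.eccent u ≤ 3 :=
  (eccent_le_iff u 3).2 (h.edist_compl_le_three u)

theorem exists_dominating_of_not_eccent_compl_le_two {u : V}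
    (hu : ¬ Gᶜ.eccent u ≤ 2) : ∃ w, G.Adj u w ∧ ∀ z, G.Adj z u ∨ G.Adj z w := by
  rw [eccent_le_iff] at hu
  push Not at hu
  obtain ⟨w, hw⟩ := hu
  have huw : G.Adj u w := by
    by_contra huw
    exact absurd (hw.trans_le (edist_compl_le_one huw)) (by decide)
  refine ⟨w, huw, ?_⟩
  by_contra hz
  rw [edist_compl_eq_two huw hz] at hw
  exact lt_irrefl _ hw

/-- If both eccentricities exceeded 2, there would be dominating edges `uw` and `vw'`. When `uv` is
not dominating, `w'` must be adjacent to `u` or `w`, which gives a triangle or a four-cycle. -/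
theorem min_eccent_compl_eq_two (h : G.IsSparse) {u v : V} (huv : G.Adj u v)
    (hz : ¬ ∀ z, G.Adj z u ∨ G.Adj z v) : min (Gᶜ.eccent u) (Gᶜ.eccent v) = 2 := by
  refine le_antisymm ?_ (le_min (h.two_le_eccent_compl u) (h.two_le_eccent_compl v))
  rw [min_le_iff]
  by_contra hc
  push Not at hc
  obtain ⟨w, huw, hw⟩ := exists_dominating_of_not_eccent_compl_le_two (not_le.2 hc.1)
  obtain ⟨w', hvw', hw'⟩ := exists_dominating_of_not_eccent_compl_le_two (not_le.2 hc.2)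
  have h1 : w' ≠ u := by
    rintro rfl
    exact hz fun z => (hw' z).symm
  rcases hw w' with h2 | h2
  · exact h.not_adj huv hvw' h2.symm
  · by_cases hvw : v = w
    · subst hvw
      exact hz hw
    · exact hvw (h.eq_of_adj huv hvw' huw h2.symm h1.symm)

open Classical in
/-- The eccentricity matrix of the complement of a sparse graph: its nonzero entries are at the
edges, with value `3` at the dominating edges and `2` at the others. -/
theorem eccMatrix_compl_apply (h : G.IsSparse) (u v : V) :
    Gᶜ.eccMatrix u v =
      if G.Adj u v then (if ∀ z, G.Adj z u ∨ G.Adj z v then 3 else 2) else 0 := by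
  rw [eccMatrix, Matrix.of_apply]
  split_ifs with h1 h2 h3 h2 h3
  · rw [dist, h.edist_compl_eq_three h2 h3]; norm_num
  · rw [dist, edist_compl_eq_two h2 h3]; norm_num
  · have := (h1.symm ▸ le_min (h.two_le_eccent_compl u) (h.two_le_eccent_compl v)).trans
      (edist_compl_le_one h2)
    exact absurd this (by decide)
  · refine absurd (le_antisymm (le_min edist_le_eccent (edist_comm.trans_le edist_le_eccent)) ?_) h1
    rw [h.edist_compl_eq_three h2 h3]
    exact (min_le_left _ _).trans (h.eccent_compl_le_three u)
  · rw [edist_compl_eq_two h2 h3, h.min_eccent_compl_eq_two h2 h3] at h1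
    exact absurd rfl h1
  · rfl

theorem eccMatrix_compl_nonneg (h : G.IsSparse) (u v : V) : 0 ≤ Gᶜ.eccMatrix u v := by
  rw [h.eccMatrix_compl_apply]
  split_ifs <;> norm_num

theorem two_le_eccMatrix_compl (h : G.IsSparse) {u v : V} (huv : G.Adj u v) :
    2 ≤ Gᶜ.eccMatrix u v := by
  rw [h.eccMatrix_compl_apply, if_pos huv]
  split_ifs <;> norm_num

end IsSparse

theorem Iso.eccSpectralRadius_compl_eq {V W : Type*} [Fintype V] [DecidableEq V] [Fintype W]
    [DecidableEq W] {G : SimpleGraph V} {H : SimpleGraph W} (φ : G ≃g H) (hG : G.IsSparse)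
    (hH : H.IsSparse) : Gᶜ.eccSpectralRadius = Hᶜ.eccSpectralRadius := by
  have hM : Hᶜ.eccMatrix = Matrix.reindexAlgEquiv ℝ ℝ φ.toEquiv Gᶜ.eccMatrix := by
    ext u v
    rw [Matrix.coe_reindexAlgEquiv, Matrix.reindex_apply, Matrix.submatrix_apply,
      hG.eccMatrix_compl_apply, hH.eccMatrix_compl_apply]
    have key : ∀ a b, G.Adj (φ.toEquiv.symm a) (φ.toEquiv.symm b) ↔ H.Adj a b := fun a b =>
      φ.symm.map_adj_iff
    have key2 : (∀ z, G.Adj z (φ.toEquiv.symm u) ∨ G.Adj z (φ.toEquiv.symm v)) ↔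
        ∀ z, H.Adj z u ∨ H.Adj z v := by
      refine (φ.toEquiv.symm.forall_congr_right).symm.trans ?_
      simp only [key]
    by_cases h1 : H.Adj u v
    · rw [if_pos h1, if_pos ((key u v).2 h1)]
      by_cases h2 : ∀ z, H.Adj z u ∨ H.Adj z v
      · rw [if_pos h2, if_pos (key2.2 h2)]
      · rw [if_neg h2, if_neg (mt key2.1 h2)]
    · rw [if_neg h1, if_neg (mt (key u v).1 h1)]
  rw [eccSpectralRadius, eccSpectralRadius, hM, AlgEquiv.spectrum_eq]

end SimpleGraph

/-! ### Rayleigh and Perron principles for symmetric matrices -/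

namespace Matrix

variable {V : Type*} [Fintype V] [DecidableEq V]

/-- The Rayleigh principle: a quadratic form value bounds the greatest eigenvalue from below, and
the vector is an eigenvector in the case of equality. -/
theorem IsHermitian.le_of_isGreatest_spectrum {M : Matrix V V ℝ} (hM : M.IsHermitian) {ξ μ : ℝ}
    (hξ : IsGreatest (spectrum ℝ M) ξ) {x : V → ℝ} (hx : x ≠ 0)
    (h : μ * (x ⬝ᵥ x) ≤ x ⬝ᵥ M *ᵥ x) : μ ≤ ξ ∧ (ξ = μ → M *ᵥ x = μ • x) := by
  have hxx : 0 < x ⬝ᵥ x := by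
    have := dotProduct_star_self_pos_iff.2 hx
    simpa using this
  have hpsd : (ξ • (1 : Matrix V V ℝ) - M).PosSemidef := by
    have hH : (ξ • (1 : Matrix V V ℝ) - M).IsHermitian := by
      refine IsHermitian.sub ?_ hM
      simp [IsHermitian]
    refine hH.posSemidef_iff_eigenvalues_nonneg.2 fun i => ?_
    have h1 := hH.eigenvalues_mem_spectrum_real i
    have h2 : ξ - hH.eigenvalues i ∈ spectrum ℝ M := by
      rw [spectrum.mem_iff, Algebra.algebraMap_eq_smul_one] at h1 ⊢
      intro h3
      apply h1
      rw [← IsUnit.neg_iff]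
      convert h3 using 1
      rw [sub_smul]
      abel
    have := hξ.2 h2
    simp only [Pi.zero_apply]
    linarith
  have hq : x ⬝ᵥ (ξ • (1 : Matrix V V ℝ) - M) *ᵥ x = ξ * (x ⬝ᵥ x) - x ⬝ᵥ M *ᵥ x := by
    simp [sub_mulVec, smul_mulVec, dotProduct_sub, dotProduct_smul]
  have h0 : 0 ≤ ξ * (x ⬝ᵥ x) - x ⬝ᵥ M *ᵥ x := by
    rw [← hq]
    simpa using hpsd.dotProduct_mulVec_nonneg x
  refine ⟨?_, ?_⟩
  · nlinarith
  · rintro rfl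
    have h1 : star x ⬝ᵥ (ξ • (1 : Matrix V V ℝ) - M) *ᵥ x = 0 := by
      rw [star_trivial, hq]
      linarith
    have h2 := (hpsd.dotProduct_mulVec_zero_iff x).1 h1
    rw [sub_mulVec, smul_mulVec, one_mulVec, sub_eq_zero] at h2
    exact h2.symm

/-- A positive eigenvector of a nonnegative symmetric matrix belongs to the greatest eigenvalue. -/
theorem IsHermitian.eq_of_isGreatest_spectrum_of_pos [Nonempty V] {M : Matrix V V ℝ}
    (hM : M.IsHermitian) (hM0 : ∀ u v, 0 ≤ M u v) {ξ μ : ℝ}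
    (hξ : IsGreatest (spectrum ℝ M) ξ) {x : V → ℝ} (hx : ∀ v, 0 < x v)
    (h : M *ᵥ x = μ • x) : ξ = μ := by
  have hx0 : x ≠ 0 := fun h0 => (hx (Classical.arbitrary V)).ne' (congrFun h0 _)
  refine le_antisymm ?_ (hM.le_of_isGreatest_spectrum hξ hx0 (by simp [h])).1
  have h1 : Module.End.HasEigenvalue (Matrix.toLin' M) ξ := by
    rw [Module.End.hasEigenvalue_iff_mem_spectrum, Matrix.spectrum_toLin']
    exact hξ.1
  obtain ⟨y, hy⟩ := h1.exists_hasEigenvector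
  have hy1 : M *ᵥ y = ξ • y := by simpa using hy.apply_eq_smul
  -- Pair the entrywise inequality `ξ |y| ≤ M |y|` with the positive eigenvector `x` and move `M`
  -- across by symmetry.
  have hle : ξ * ∑ v, x v * |y v| ≤ μ * ∑ v, x v * |y v| := by
    calc ξ * ∑ v, x v * |y v| = ∑ v, x v * (ξ * |y v|) := by
          rw [Finset.mul_sum]; exact Finset.sum_congr rfl fun v _ => by ring
      _ ≤ ∑ v, x v * ∑ u, M v u * |y u| := by
          refine Finset.sum_le_sum fun v _ => mul_le_mul_of_nonneg_left ?_ (hx v).le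
          have h2 : ∑ u, M v u * y u = ξ * y v := congrFun hy1 v
          calc ξ * |y v| ≤ |ξ * y v| := by
                rw [abs_mul]; exact mul_le_mul_of_nonneg_right (le_abs_self _) (abs_nonneg _)
            _ = |∑ u, M v u * y u| := by rw [h2]
            _ ≤ ∑ u, |M v u * y u| := Finset.abs_sum_le_sum_abs _ _
            _ = ∑ u, M v u * |y u| := Finset.sum_congr rfl fun u _ => by
                rw [abs_mul, abs_of_nonneg (hM0 v u)]
      _ = ∑ u, (∑ v, M u v * x v) * |y u| := by
          simp only [Finset.mul_sum, Finset.sum_mul]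
          rw [Finset.sum_comm]
          refine Finset.sum_congr rfl fun u _ => Finset.sum_congr rfl fun v _ => ?_
          have : M v u = M u v := by simpa using hM.apply u v
          rw [this]; ring
      _ = μ * ∑ v, x v * |y v| := by
          rw [Finset.mul_sum]
          refine Finset.sum_congr rfl fun u _ => ?_
          have h2 : ∑ v, M u v * x v = μ * x u := congrFun h u
          rw [h2]; ring
  refine le_of_mul_le_mul_right hle ?_
  obtain ⟨v, hv⟩ := Function.ne_iff.1 hy.2
  exact Finset.sum_pos' (fun u _ => mul_nonneg (hx u).le (abs_nonneg _))
    ⟨v, Finset.mem_univ v, mul_pos (hx v) (abs_pos.2 hv)⟩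

end Matrix

/-! ### Centres and the numbering of a connected graph -/

namespace SimpleGraph

variable {V : Type*} {G : SimpleGraph V}

theorem Connected.exists_adj_dist_add_one_eq (hG : G.Connected) {c v : V} (hv : v ≠ c) :
    ∃ u, G.Adj v u ∧ G.dist c u + 1 = G.dist c v := by
  obtain ⟨w, hw⟩ := hG.exists_walk_length_eq_dist v c
  cases w with
  | nil => exact absurd rfl hv
  | @cons _ u _ h p =>
    refine ⟨u, h, ?_⟩
    have h1 := dist_le p
    have h2 := hG.dist_triangle (u := c) (v := u) (w := v)
    have h3 : G.dist u v = 1 := dist_eq_one_iff_adj.2 h.symm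
    rw [Walk.length_cons, dist_comm] at hw
    rw [dist_comm] at h1
    omega

theorem Connected.exists_dist_eq_add (hG : G.Connected) (c v : V) (k : ℕ) (hk : k ≤ G.dist c v) :
    ∃ u, G.dist c u = k ∧ G.dist c v = k + G.dist u v := by
  induction hd : G.dist c v - k generalizing v with
  | zero => exact ⟨v, by omega, by simp; omega⟩
  | succ d ih =>
    have hv : v ≠ c := by
      rintro rfl
      simp at hd
    obtain ⟨w, hvw, hw⟩ := hG.exists_adj_dist_add_one_eq hv
    obtain ⟨u, hu, huv⟩ := ih w (by omega) (by omega)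
    refine ⟨u, hu, ?_⟩
    have h1 := hG.dist_triangle (u := u) (v := w) (w := v)
    have h2 := hG.dist_triangle (u := c) (v := u) (w := v)
    have h3 : G.dist w v = 1 := dist_eq_one_iff_adj.2 hvw.symm
    omega

theorem Connected.exists_geodesic (hG : G.Connected) (c v : V) :
    ∃ a : ℕ → V, ∀ k ≤ G.dist c v, G.dist c (a k) = k ∧
      (k < G.dist c v → G.Adj (a (k + 1)) (a k)) := by
  obtain ⟨w, hw⟩ := hG.exists_walk_length_eq_dist c v
  refine ⟨w.getVert, fun k hk => ⟨?_, fun hk' => (w.adj_getVert_succ (by omega)).symm⟩⟩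
  have h1 := dist_le (w.take k)
  have h2 := dist_le (w.drop k)
  have h3 := hG.dist_triangle (u := c) (v := w.getVert k) (w := v)
  rw [Walk.take_length] at h1
  rw [Walk.drop_length] at h2
  omega

/-- A centre of a finite connected graph: every intermediate distance from it is attained at two
vertices. -/
theorem Connected.exists_center [Finite V] (hG : G.Connected) :
    ∃ c f : V, (∀ v, G.dist c v ≤ G.dist c f) ∧
      ∀ w, 0 < G.dist c w → G.dist c w < G.dist c f → ∃ w', w' ≠ w ∧ G.dist c w' = G.dist c w := by
  have := hG.nonempty
  have hfar : ∀ c, ∃ f, ∀ v, G.dist c v ≤ G.dist c f := fun c => Finite.exists_max (G.dist c)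
  choose f hf using hfar
  obtain ⟨c, hc⟩ := Finite.exists_min fun c => G.dist c (f c)
  refine ⟨c, f c, hf c, fun w hw0 hw => ?_⟩
  -- Here `c` minimises eccentricity. If `w` were alone on its level, one step from `c` towards `w`
  -- would lower it: farther vertices are reached through `w`, and nearer ones have slack.
  by_contra hcon
  push Not at hcon
  obtain ⟨b, hb, hbw⟩ := hG.exists_dist_eq_add c w 1 hw0
  have h1 := hc b
  have h2 := hG.dist_triangle (u := b) (v := c) (w := f b)
  have h3 := hG.dist_triangle (u := b) (v := w) (w := f b)
  have h4 : G.dist b c = 1 := by rw [dist_comm]; exact hb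
  have h5 := hf c (f b)
  rcases lt_or_ge (G.dist c (f b)) (G.dist c w) with h | h
  · omega
  · obtain ⟨u, hu, huv⟩ := hG.exists_dist_eq_add c (f b) (G.dist c w) h
    have : u = w := by
      by_contra hne
      exact hcon u hne hu
    subst this
    omega

/-- An injective key on a finite set with `n` elements is order-equivalent to a numbering. -/
theorem exists_numbering_of_injective [Fintype V] {κ : V → ℕ} (hκ : Function.Injective κ) :
    ∃ σ : V → ℕ, Function.Injective σ ∧ (∀ v, σ v < Fintype.card V) ∧
      (∀ u v, κ u < κ v → σ u < σ v) ∧ ∀ v, (∀ u, κ v ≤ κ u) → σ v = 0 := by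
  classical
  have hmono : ∀ u v, κ u < κ v →
      (Finset.univ.filter fun w => κ w < κ u).card < (Finset.univ.filter fun w => κ w < κ v).card :=
    fun u v h => Finset.card_lt_card <| by
      refine Finset.ssubset_iff_subset_ne.2 ⟨fun w hw => ?_, fun he => ?_⟩
      · simp only [Finset.mem_filter, Finset.mem_univ, true_and] at hw ⊢
        omega
      · have : u ∈ Finset.univ.filter fun w => κ w < κ v := by simpa using h
        rw [← he] at this
        simp at this
  refine ⟨fun v => (Finset.univ.filter fun w => κ w < κ v).card, fun u v huv => ?_, fun v => ?_,
    hmono, fun v hv => by simpa using hv⟩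
  · by_contra hne
    rcases lt_or_gt_of_ne fun h => hne (hκ h) with h | h
    · exact (hmono u v h).ne huv
    · exact (hmono v u h).ne' huv
  · refine Finset.card_lt_card (Finset.ssubset_iff_subset_ne.2 ⟨Finset.subset_univ _, fun he => ?_⟩)
    have : v ∈ Finset.univ.filter fun w => κ w < κ v := by rw [he]; exact Finset.mem_univ v
    simp at this

/-- The vertices of a finite connected graph can be numbered so that each vertex is joined to one
whose number is smaller by at least two (or to the first one). -/
theorem Connected.exists_numbering [Fintype V] (hG : G.Connected) :
    ∃ (σ : V → ℕ) (p : V → V), Function.Injective σ ∧ (∀ v, σ v < Fintype.card V) ∧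
      ∀ v, 0 < σ v → G.Adj v (p v) ∧ σ (p v) ≤ σ v - 2 := by
  classical
  obtain ⟨c, f, hf, hlevel⟩ := hG.exists_center
  obtain ⟨a, ha⟩ := hG.exists_geodesic c f
  set n := Fintype.card V
  let e := Fintype.equivFin V
  -- The key `κ` sorts by distance from `c`, and within each level puts the vertex of the geodesic
  -- to `f` first.
  let off : V → ℕ := fun v => if v = a (G.dist c v) then 0 else (e v : ℕ) + 1
  have hoff : ∀ v, off v < n + 1 := fun v => by
    have := (e v).2
    simp only [off]
    split_ifs <;> omega
  let κ : V → ℕ := fun v => G.dist c v * (n + 1) + off v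
  have hκlt : ∀ u v, G.dist c u < G.dist c v → κ u < κ v := fun u v h => by
    have h1 := hoff u
    have h2 : (G.dist c u + 1) * (n + 1) ≤ G.dist c v * (n + 1) := Nat.mul_le_mul_right _ h
    simp only [κ]
    linarith
  have hκeq : ∀ u v, κ u = κ v → G.dist c u = G.dist c v := fun u v h => by
    rcases lt_trichotomy (G.dist c u) (G.dist c v) with h' | h' | h'
    · exact absurd h (hκlt u v h').ne
    · exact h'
    · exact absurd h (hκlt v u h').ne'
  have hκ : Function.Injective κ := fun u v h => by
    have h1 := hκeq u v h
    have h2 : off u = off v := by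
      simp only [κ, h1] at h
      omega
    simp only [off] at h2
    split_ifs at h2 with h3 h4
    · rw [h3, h4, h1]
    · exact e.injective (Fin.ext (by omega))
  obtain ⟨σ, hσ, hσn, hσκ, hσ0⟩ := exists_numbering_of_injective hκ
  have harm : ∀ k ≤ G.dist c f, ∀ w, w ≠ a k → G.dist c w = k → κ (a k) < κ w := by
    intro k hk w hw hwk
    have h1 := (ha k hk).1
    simp only [κ, off, h1, hwk, if_neg hw, if_true]
    omega
  choose! q hq using fun v (hv : v ≠ c) => hG.exists_adj_dist_add_one_eq hv
  refine ⟨σ, fun v => if v = a (G.dist c v) then a (G.dist c v - 1) else q v, hσ, hσn,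
    fun v hv => ?_⟩
  have hac : a 0 = c := (hG.dist_eq_zero_iff.1 (ha 0 (Nat.zero_le _)).1).symm
  have hσc : σ c = 0 := hσ0 c fun u => by
    have : κ c = 0 := by simp [κ, off, hac]
    omega
  have hvc : v ≠ c := by
    rintro rfl
    omega
  have hpos := hG.pos_dist_of_ne hvc.symm
  have hvf := hf v
  by_cases hva : v = a (G.dist c v)
  · simp only [if_pos hva]
    obtain ⟨k, hk⟩ : ∃ k, G.dist c v = k + 1 := ⟨G.dist c v - 1, by omega⟩
    rw [hk, Nat.add_sub_cancel]
    rw [hk] at hva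
    have hak := ha k (by omega)
    refine ⟨hva ▸ hak.2 (by omega), ?_⟩
    by_cases hk0 : k = 0
    · rw [hk0, hac, hσc]
      exact Nat.zero_le _
    -- A second vertex `w` on level `k` is numbered strictly between `a k` and `v`, which gives the
    -- gap of two.
    · obtain ⟨w, hw, hwk⟩ := hlevel (a k) (by omega) (by omega)
      have h1 := hσκ _ _ (harm k (by omega) w hw (by omega))
      have h2 := hσκ _ _ (hκlt w v (by omega))
      omega
  · simp only [if_neg hva]
    obtain ⟨h1, h2⟩ := hq v hvc
    refine ⟨h1, ?_⟩
    -- Off the geodesic, the first vertex of the level of `v` separates `q v` from `v`.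
    have h3 := hσκ _ _ (harm _ hvf v hva rfl)
    have h4 := hσκ (q v) (a (G.dist c v)) (hκlt _ _ (by rw [(ha _ hvf).1]; omega))
    omega

end SimpleGraph

/-! ### The path eigenvector, listed from the middle outwards -/

/-- The entries `sin (i * π / (n + 1))`, `1 ≤ i ≤ n`, of the positive eigenvector of the path on
`n` vertices, listed from the middle of the path outwards and continued beyond `n`. -/
noncomputable def zigzagSin (n j : ℕ) : ℝ :=
  Real.cos (((if Odd (n + j) then j else j + 1 : ℕ) : ℝ) * (Real.pi / (2 * (n + 1))))

theorem zigzagSin_pos {n j : ℕ} (hj : j < n) : 0 < zigzagSin n j := by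
  have hn : (0 : ℝ) < 2 * (n + 1) := by positivity
  have hk : (if Odd (n + j) then j else j + 1 : ℕ) < n + 1 := by split_ifs <;> omega
  have hk' : ((if Odd (n + j) then j else j + 1 : ℕ) : ℝ) < n + 1 := by exact_mod_cast hk
  have hpi := Real.pi_pos
  apply Real.cos_pos_of_mem_Ioo
  constructor
  · have : 0 ≤ ((if Odd (n + j) then j else j + 1 : ℕ) : ℝ) * (Real.pi / (2 * (n + 1))) := by
      positivity
    linarith
  · rw [mul_div_assoc', div_lt_div_iff₀ hn two_pos]
    nlinarith

theorem zigzagSin_anti {n i j : ℕ} (hij : i ≤ j) (hj : j < n) :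
    zigzagSin n j ≤ zigzagSin n i := by
  have hn : (0 : ℝ) < 2 * (n + 1) := by positivity
  have hpi := Real.pi_pos
  have hk : (if Odd (n + j) then j else j + 1 : ℕ) < n + 1 := by split_ifs <;> omega
  have hk' : ((if Odd (n + j) then j else j + 1 : ℕ) : ℝ) < n + 1 := by exact_mod_cast hk
  have hik : (if Odd (n + i) then i else i + 1 : ℕ) ≤ if Odd (n + j) then j else j + 1 := by
    rcases hij.eq_or_lt with rfl | h
    · rfl
    · split_ifs with h1 h2 h2
      · omega
      · omega
      · omega
      · omega
  have hik' : ((if Odd (n + i) then i else i + 1 : ℕ) : ℝ) ≤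
    ((if Odd (n + j) then j else j + 1 : ℕ) : ℝ) := by exact_mod_cast hik
  refine Real.cos_le_cos_of_nonneg_of_le_pi (by positivity) ?_
    (mul_le_mul_of_nonneg_right hik' (by positivity))
  rw [mul_div_assoc', div_le_iff₀ hn]
  nlinarith

/-- Indices `n` and `n + 1` stand for the two virtual vertices just beyond the ends of the path,
where the sine vanishes. -/
theorem zigzagSin_self (n : ℕ) : zigzagSin n n = 0 := by
  have h : ¬ Odd (n + n) := by simp [← two_mul]
  rw [zigzagSin, if_neg h, ← Real.cos_pi_div_two]
  congr 1
  push_cast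
  field_simp

theorem zigzagSin_succ_self (n : ℕ) : zigzagSin n (n + 1) = 0 := by
  have h : Odd (n + (n + 1)) := ⟨n, by ring⟩
  rw [zigzagSin, if_pos h, ← Real.cos_pi_div_two]
  congr 1
  push_cast
  field_simp

/-- Product-to-sum with `a = |m - 2|`; evenness of the cosine covers reflection at the middle of the
path. -/
theorem two_mul_cos_mul_cos_of_eq (n : ℕ) {m a b : ℕ} (ha : a + 2 = m ∨ a + m = 2)
    (hb : b = m + 2) :
    2 * Real.cos (Real.pi / (n + 1)) * Real.cos ((m : ℝ) * (Real.pi / (2 * (n + 1)))) =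
      Real.cos ((a : ℝ) * (Real.pi / (2 * (n + 1)))) +
        Real.cos ((b : ℝ) * (Real.pi / (2 * (n + 1)))) := by
  have hn : ((n : ℝ) + 1) ≠ 0 := by positivity
  have h1 : Real.pi / (n + 1) = 2 * (Real.pi / (2 * (n + 1))) := by field_simp
  set φ := Real.pi / (2 * ((n : ℝ) + 1))
  have h2 : Real.cos ((a : ℝ) * φ) = Real.cos ((m : ℝ) * φ - 2 * φ) := by
    rcases ha with rfl | ha
    · congr 1; push_cast; ring
    · have : (a : ℝ) = 2 - m := by rw [eq_sub_iff_add_eq]; exact_mod_cast ha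
      rw [this, ← Real.cos_neg]
      congr 1; ring
  have h3 : ((b : ℕ) : ℝ) * φ = (m : ℝ) * φ + 2 * φ := by rw [hb]; push_cast; ring
  rw [h1, h2, h3, Real.cos_sub, Real.cos_add]
  ring

/-- The listing alternates sides, so the path neighbours of index `j + 2` are `j` and `j + 4`. Near
the middle, 0 has neighbours 1 and 2, and 1 has neighbours 0 and 3. -/
theorem zigzagSin_add_two (n j : ℕ) : 2 * Real.cos (Real.pi / (n + 1)) * zigzagSin n (j + 2) =
    zigzagSin n j + zigzagSin n (j + 4) := by
  have e1 : Odd (n + (j + 2)) ↔ Odd (n + j) := by simp only [Nat.odd_iff]; omega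
  have e2 : Odd (n + (j + 4)) ↔ Odd (n + j) := by simp only [Nat.odd_iff]; omega
  simp only [zigzagSin, e1, e2]
  apply two_mul_cos_mul_cos_of_eq <;> split_ifs <;> omega

theorem zigzagSin_zero (n : ℕ) : 2 * Real.cos (Real.pi / (n + 1)) * zigzagSin n 0 =
    zigzagSin n 1 + zigzagSin n 2 := by
  have e1 : Odd (n + 1) ↔ ¬ Odd n := by simp only [Nat.odd_iff]; omega
  have e2 : Odd (n + 2) ↔ Odd n := by simp only [Nat.odd_iff]; omega
  simp only [zigzagSin, e1, e2, add_zero]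
  apply two_mul_cos_mul_cos_of_eq <;> split_ifs <;> omega

theorem zigzagSin_one (n : ℕ) : 2 * Real.cos (Real.pi / (n + 1)) * zigzagSin n 1 =
    zigzagSin n 0 + zigzagSin n 3 := by
  have e1 : Odd (n + 1) ↔ ¬ Odd n := by simp only [Nat.odd_iff]; omega
  have e2 : Odd (n + 3) ↔ ¬ Odd n := by simp only [Nat.odd_iff]; omega
  simp only [zigzagSin, e1, e2, add_zero]
  apply two_mul_cos_mul_cos_of_eq <;> split_ifs <;> omega

theorem sum_zigzagSin_sq_aux (n k : ℕ) :
    2 * Real.cos (Real.pi / (n + 1)) * ∑ j ∈ Finset.range (k + 2), zigzagSin n j ^ 2 =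
      2 * (zigzagSin n 0 * zigzagSin n 1 +
        ∑ j ∈ Finset.range k, zigzagSin n (j + 2) * zigzagSin n j) +
      zigzagSin n (k + 2) * zigzagSin n k + zigzagSin n (k + 3) * zigzagSin n (k + 1) := by
  induction k with
  | zero =>
    simp only [zero_add, Finset.sum_range_succ, Finset.sum_range_zero]
    linear_combination zigzagSin n 0 * zigzagSin_zero n + zigzagSin n 1 * zigzagSin_one n
  | succ k ih =>
    rw [show k + 1 + 2 = k + 2 + 1 by ring, Finset.sum_range_succ, mul_add, ih,
      Finset.sum_range_succ]
    have := zigzagSin_add_two n k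
    simp only [show k + 2 + 1 = k + 3 by ring, show k + 1 + 3 = k + 4 by ring,
      show k + 1 + 1 = k + 2 by ring]
    linear_combination zigzagSin n (k + 2) * this

theorem sum_zigzagSin_sq {n : ℕ} (hn : 2 ≤ n) :
    2 * Real.cos (Real.pi / (n + 1)) * ∑ j ∈ Finset.range n, zigzagSin n j ^ 2 =
      2 * ∑ j ∈ Finset.range n, if j = 0 then 0 else zigzagSin n j * zigzagSin n (j - 2) := by
  obtain ⟨k, rfl⟩ := Nat.exists_eq_add_of_le' hn
  -- The boundary terms vanish; truncation `1 - 2 = 0` makes the `j = 1` term the edge between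
  -- indices 0 and 1.
  rw [sum_zigzagSin_sq_aux, zigzagSin_self, zigzagSin_succ_self, Finset.sum_range_succ',
    Finset.sum_range_succ']
  simp
  ring

theorem sum_comp_eq_sum_range {V : Type*} [Fintype V] {σ : V → ℕ} (hσ : Function.Injective σ)
    (hσn : ∀ v, σ v < Fintype.card V) (f : ℕ → ℝ) :
    ∑ v, f (σ v) = ∑ j ∈ Finset.range (Fintype.card V), f j := by
  have h : Finset.univ.map ⟨σ, hσ⟩ = Finset.range (Fintype.card V) :=
    Finset.eq_of_subset_of_card_le
      (fun j hj => by
        obtain ⟨v, -, rfl⟩ := Finset.mem_map.1 hj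
        exact Finset.mem_range.2 (hσn v))
      (by simp)
  rw [← h, Finset.sum_map]
  rfl

theorem exists_eq_of_injective_of_lt_card {V : Type*} [Fintype V] {σ : V → ℕ}
    (hσ : Function.Injective σ) (hσn : ∀ v, σ v < Fintype.card V) {j : ℕ}
    (hj : j < Fintype.card V) : ∃ v, σ v = j := by
  have hinj : Function.Injective fun v => (⟨σ v, hσn v⟩ : Fin (Fintype.card V)) :=
    fun u v h => hσ (by simpa using h)
  obtain ⟨v, hv⟩ := ((Fintype.bijective_iff_injective_and_card _).2
    ⟨hinj, (Fintype.card_fin _).symm⟩).2 ⟨j, hj⟩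
  exact ⟨v, by simpa using hv⟩

/-! ### Comparison with the path and the equality case -/

section Numbering

variable {V : Type*} [Fintype V] {M : Matrix V V ℝ} {σ : V → ℕ} {p : V → V}

theorem two_mul_cos_mul_dotProduct_zigzagSin_le (hcard : 2 ≤ Fintype.card V)
    (hM : M.IsHermitian) (hM0 : ∀ u v, 0 ≤ M u v) (hσ : Function.Injective σ)
    (hσn : ∀ v, σ v < Fintype.card V) (hp : ∀ v, 0 < σ v → σ (p v) ≤ σ v - 2)
    (hMp : ∀ v, 0 < σ v → 2 ≤ M v (p v)) {x : V → ℝ}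
    (hx : x = fun v => zigzagSin (Fintype.card V) (σ v)) :
    4 * Real.cos (Real.pi / (Fintype.card V + 1)) * (x ⬝ᵥ x) ≤ x ⬝ᵥ M.mulVec x := by
  classical
  set n := Fintype.card V
  have hxpos : ∀ v, 0 < x v := fun v => by rw [hx]; exact zigzagSin_pos (hσn v)
  have hsymm : ∀ u v, M u v = M v u := fun u v => by simpa using hM.apply v u
  -- `B` puts weight 2 on each pair `(u, p u)`. Since `p` lowers the number, no pair is counted in
  -- both directions, so `M` dominates `B` plus its transpose.
  let B : V → V → ℝ := fun u v => if 0 < σ u ∧ p u = v then 2 else 0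
  have hB : ∀ u v, B u v + B v u ≤ M u v := fun u v => by
    simp only [B]
    split_ifs with h1 h2 h2
    · have h3 := hp u h1.1
      have h4 := hp v h2.1
      rw [h1.2] at h3
      rw [h2.2] at h4
      omega
    · rw [← h1.2, add_zero]; exact hMp u h1.1
    · rw [hsymm, ← h2.2, zero_add]; exact hMp v h2.1
    · simpa using hM0 u v
  have hBsum : ∀ u, ∑ v, x u * (B u v * x v) = if 0 < σ u then 2 * (x u * x (p u)) else 0 := by
    intro u
    by_cases hu : 0 < σ u
    · simp only [B, hu, true_and, if_true, ite_mul, zero_mul, mul_ite, mul_zero]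
      rw [Finset.sum_ite_eq]
      simp only [Finset.mem_univ, if_true]
      ring
    · simp [B, hu]
  have hterm : ∀ u, (if 0 < σ u then 2 * (x u * x (p u)) else 0) ≥
      2 * (if σ u = 0 then 0 else zigzagSin n (σ u) * zigzagSin n (σ u - 2)) := by
    intro u
    by_cases hu : 0 < σ u
    · rw [if_pos hu, if_neg hu.ne']
      have h1 : zigzagSin n (σ u - 2) ≤ x (p u) := by
        rw [hx]
        exact zigzagSin_anti (hp u hu) (by have := hσn u; omega)
      have h2 : zigzagSin n (σ u) = x u := by rw [hx]
      rw [h2]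
      have := mul_le_mul_of_nonneg_left h1 (hxpos u).le
      linarith
    · rw [if_neg hu, if_pos (by omega)]
      simp
  have hsq : x ⬝ᵥ x = ∑ j ∈ Finset.range n, zigzagSin n j ^ 2 := by
    rw [← sum_comp_eq_sum_range hσ hσn, hx]
    exact Finset.sum_congr rfl fun v _ => (sq _).symm
  calc 4 * Real.cos (Real.pi / (n + 1)) * (x ⬝ᵥ x)
      = 2 * ∑ u, 2 * (if σ u = 0 then 0 else zigzagSin n (σ u) * zigzagSin n (σ u - 2)) := by
        rw [hsq, ← Finset.mul_sum, sum_comp_eq_sum_range hσ hσn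
          fun j => if j = 0 then 0 else zigzagSin n j * zigzagSin n (j - 2)]
        linear_combination 2 * sum_zigzagSin_sq hcard
    _ ≤ 2 * ∑ u, ∑ v, x u * (B u v * x v) := by
        refine mul_le_mul_of_nonneg_left (Finset.sum_le_sum fun u _ => ?_) two_pos.le
        rw [hBsum]
        exact hterm u
    _ = ∑ u, ∑ v, x u * ((B u v + B v u) * x v) := by
        have : ∑ u, ∑ v, x u * (B v u * x v) = ∑ u, ∑ v, x u * (B u v * x v) := by
          rw [Finset.sum_comm]
          exact Finset.sum_congr rfl fun u _ => Finset.sum_congr rfl fun v _ => by ring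
        rw [two_mul]
        nth_rewrite 2 [← this]
        rw [← Finset.sum_add_distrib]
        refine Finset.sum_congr rfl fun u _ => ?_
        rw [← Finset.sum_add_distrib]
        exact Finset.sum_congr rfl fun v _ => by ring
    _ ≤ ∑ u, ∑ v, x u * (M u v * x v) :=
        Finset.sum_le_sum fun u _ => Finset.sum_le_sum fun v _ =>
          mul_le_mul_of_nonneg_left (mul_le_mul_of_nonneg_right (hB u v) (hxpos v).le) (hxpos u).le
    _ = x ⬝ᵥ M.mulVec x := by
        simp only [dotProduct, Matrix.mulVec, Finset.mul_sum]

/-- At the smallest-numbered failure `v`, the vertex `p v` already has both of its path neighbours,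
whose values alone fill its row of the eigenvalue equation. The extra positive contribution of `v`
is impossible. -/
theorem eq_sub_two_of_mulVec_zigzagSin_eq (hM : M.IsHermitian) (hM0 : ∀ u v, 0 ≤ M u v)
    (hσ : Function.Injective σ) (hσn : ∀ v, σ v < Fintype.card V)
    (hp : ∀ v, 0 < σ v → σ (p v) ≤ σ v - 2) (hMp : ∀ v, 0 < σ v → 2 ≤ M v (p v)) {x : V → ℝ}
    (hx : x = fun v => zigzagSin (Fintype.card V) (σ v))
    (hMx : M.mulVec x = (4 * Real.cos (Real.pi / (Fintype.card V + 1))) • x) (v : V)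
    (hv : 0 < σ v) : σ (p v) = σ v - 2 := by
  classical
  set n := Fintype.card V
  have hxpos : ∀ v, 0 < x v := fun v => by rw [hx]; exact zigzagSin_pos (hσn v)
  have hxv : ∀ v, x v = zigzagSin n (σ v) := fun v => by rw [hx]
  have hsymm : ∀ u v, M u v = M v u := fun u v => by simpa using hM.apply v u
  have hMp' : ∀ v, 0 < σ v → 2 ≤ M (p v) v := fun v h => hsymm v _ ▸ hMp v h
  have hrow : ∀ u a b c, a ≠ b → a ≠ c → b ≠ c → 2 ≤ M u a → 2 ≤ M u b → 2 ≤ M u c →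
      2 * Real.cos (Real.pi / (n + 1)) * x u ≠ x a + x b := by
    intro u a b c hab hac hbc ha hb hc he
    have h1 : ∑ w, M u w * x w = (4 * Real.cos (Real.pi / (n + 1))) * x u := congrFun hMx u
    have h2 : ∑ w ∈ {a, b, c}, M u w * x w ≤ ∑ w, M u w * x w :=
      Finset.sum_le_sum_of_subset_of_nonneg (Finset.subset_univ _)
        fun w _ _ => mul_nonneg (hM0 u w) (hxpos w).le
    rw [Finset.sum_insert (by simp [hab, hac]), Finset.sum_insert (by simp [hbc]),
      Finset.sum_singleton] at h2
    have h3 := mul_le_mul_of_nonneg_right ha (hxpos a).le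
    have h4 := mul_le_mul_of_nonneg_right hb (hxpos b).le
    have h5 := mul_le_mul_of_nonneg_right hc (hxpos c).le
    have h6 := hxpos c
    linarith
  induction hj : σ v using Nat.strong_induction_on generalizing v with
  | _ j ih =>
    subst hj
    by_contra hne
    have hle := hp v hv
    set u := p v with hu
    have hvn := hσn v
    have hchild : ∀ w, 0 < σ w → σ w < σ v → σ u = σ w - 2 → 2 ≤ M u w := by
      intro w hw0 hwv huw
      have : p w = u := hσ ((ih _ hwv w hw0 rfl).trans huw.symm)
      exact this ▸ hMp' w hw0
    have hσne : ∀ {a b}, σ a ≠ σ b → a ≠ b := fun h h' => h (h' ▸ rfl)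
    obtain ⟨b, hb⟩ := exists_eq_of_injective_of_lt_card hσ hσn (j := σ u + 2) (by omega)
    have hbM := hchild b (by omega) (by omega) (by omega)
    rcases Nat.eq_zero_or_pos (σ u) with h0 | h0
    · obtain ⟨a, ha⟩ := exists_eq_of_injective_of_lt_card hσ hσn (j := 1) (by omega)
      refine hrow u a b v (hσne (by omega)) (hσne (by omega)) (hσne (by omega))
        (hchild a (by omega) (by omega) (by omega)) hbM (hMp' v hv) ?_
      rw [hxv, hxv, hxv, h0, ha, hb, h0]
      exact zigzagSin_zero n
    · have ha := ih (σ u) (by omega) u h0 rfl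
      refine hrow u (p u) b v (hσne (by omega)) (hσne (by omega)) (hσne (by omega))
        (hMp u h0) hbM (hMp' v hv) ?_
      rw [hxv, hxv, hxv, ha, hb]
      rcases Nat.eq_or_lt_of_le (Nat.succ_le_of_lt h0) with h1 | h1
      · rw [← h1]
        exact zigzagSin_one n
      · obtain ⟨k, hk⟩ := Nat.exists_eq_add_of_le' (Nat.succ_le_of_lt h1)
        rw [hk]
        exact zigzagSin_add_two n k

end Numbering

/-! ### Recognising the path, its spectral radius, and order four -/

namespace SimpleGraph

theorem IsTree.nonempty_iso_pathGraph {V : Type*} [Fintype V] {T : SimpleGraph V}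
    (hT : T.IsTree) {n : ℕ} (hcard : Fintype.card V = n) {σ : V → ℕ} {p : V → V}
    (hσ : Function.Injective σ) (hσn : ∀ v, σ v < n) (hadj : ∀ v, 0 < σ v → T.Adj v (p v))
    (hp : ∀ v, 0 < σ v → σ (p v) = σ v - 2) : Nonempty (T ≃g pathGraph n) := by
  -- Even numbers go left from the middle and odd numbers go right.
  let g : V → Fin n := fun v =>
    ⟨if σ v % 2 = 0 then (n - 1) / 2 - σ v / 2 else (n - 1) / 2 + (σ v + 1) / 2, by
      have := hσn v
      split_ifs <;> omega⟩
  have hg : Function.Injective g := fun u v h => by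
    have h1 := Fin.ext_iff.1 h
    have h2 := hσn u
    have h3 := hσn v
    simp only [g] at h1
    apply hσ
    split_ifs at h1 <;> omega
  let e : V ≃ Fin n := Equiv.ofBijective g
    ((Fintype.bijective_iff_injective_and_card g).2 ⟨hg, by simpa using hcard⟩)
  have hle : (pathGraph n).comap e ≤ T := by
    intro u v huv
    have h1 : (g u : ℕ) + 1 = g v ∨ (g v : ℕ) + 1 = g u := pathGraph_adj.1 huv
    have h2 := hσn u
    have h3 := hσn v
    have h4 : (0 < σ u ∧ σ v = σ u - 2) ∨ (0 < σ v ∧ σ u = σ v - 2) := by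
      simp only [g] at h1
      split_ifs at h1 <;> omega
    rcases h4 with ⟨h5, h6⟩ | ⟨h5, h6⟩
    · have : p u = v := hσ ((hp u h5).trans h6.symm)
      exact this ▸ hadj u h5
    · have : p v = u := hσ ((hp v h5).trans h6.symm)
      exact (this ▸ hadj v h5).symm
  have hconn : ((pathGraph n).comap e).Connected := by
    obtain ⟨m, rfl⟩ : ∃ m, n = m + 1 := by
      have := hT.connected.nonempty
      exact ⟨n - 1, by have := Fintype.card_pos (α := V); omega⟩
    exact (Iso.comap e (pathGraph (m + 1))).connected_iff.2 (pathGraph_connected m)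
  -- A tree is minimally connected, so a connected spanning subgraph is the whole tree.
  have heq : (pathGraph n).comap e = T :=
    le_antisymm hle ((isTree_iff_minimal_connected.1 hT).2 hconn hle)
  exact heq ▸ ⟨Iso.comap e (pathGraph n)⟩

theorem isSparse_pathGraph {n : ℕ} (hn : 4 ≤ n) : (pathGraph n).IsSparse where
  exists_adj u := by
    by_cases hu : (u : ℕ) = 0
    · exact ⟨⟨1, by omega⟩, pathGraph_adj.2 (Or.inl (by simp [hu]))⟩
    · exact ⟨⟨u - 1, by omega⟩, pathGraph_adj.2 (Or.inr (by simp; omega))⟩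
  exists_compl_adj u := by
    by_cases hu : (u : ℕ) ≤ 1
    · refine ⟨⟨3, by omega⟩, ?_⟩
      rw [compl_adj, pathGraph_adj, Ne, Fin.ext_iff]
      simp only
      omega
    · refine ⟨⟨0, by omega⟩, ?_⟩
      rw [compl_adj, pathGraph_adj, Ne, Fin.ext_iff]
      simp only
      omega
  not_adj := by
    intro u w v h1 h2 h3
    rw [pathGraph_adj] at h1 h2 h3
    omega
  eq_of_adj := by
    intro u a v b h1 h2 h3 h4 h5
    rw [pathGraph_adj] at h1 h2 h3 h4
    rw [Ne, Fin.ext_iff] at h5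
    rw [Fin.ext_iff]
    omega

theorem eccMatrix_compl_pathGraph_apply {n : ℕ} (hn : 5 ≤ n) (i j : Fin n) :
    (pathGraph n)ᶜ.eccMatrix i j =
      (if (i : ℕ) + 1 = j then 2 else 0) + if (j : ℕ) + 1 = i then 2 else 0 := by
  rw [(isSparse_pathGraph (by omega)).eccMatrix_compl_apply]
  by_cases h : (pathGraph n).Adj i j
  · rw [if_pos h, if_neg]
    · rw [pathGraph_adj] at h
      rcases h with h | h
      · rw [if_pos h, if_neg (by omega), add_zero]
      · rw [if_neg (by omega), if_pos h, zero_add]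
    · intro hz
      have h0 := hz ⟨0, by omega⟩
      have h4 := hz ⟨4, by omega⟩
      rw [pathGraph_adj] at h
      simp only [pathGraph_adj] at h0 h4
      omega
  · rw [if_neg h]
    rw [pathGraph_adj] at h
    push Not at h
    rw [if_neg h.1, if_neg h.2, add_zero]

theorem eccSpectralRadius_compl_pathGraph {n : ℕ} (hn : 5 ≤ n) :
    (pathGraph n)ᶜ.eccSpectralRadius = 4 * Real.cos (Real.pi / ((n : ℝ) + 1)) := by
  have : NeZero n := ⟨by omega⟩
  set θ := Real.pi / ((n : ℝ) + 1) with hθ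
  have hn0 : (0 : ℝ) < n + 1 := by positivity
  have hθ0 : 0 < θ := div_pos Real.pi_pos hn0
  have hθn : ((n : ℝ) + 1) * θ = Real.pi := by rw [hθ]; field_simp
  refine (eccMatrix_isHermitian _).eq_of_isGreatest_spectrum_of_pos
    (isSparse_pathGraph (by omega)).eccMatrix_compl_nonneg (isGreatest_eccSpectralRadius _)
    (x := fun i => Real.sin (((i : ℕ) + 1 : ℝ) * θ)) (fun i => ?_) ?_
  · refine Real.sin_pos_of_pos_of_lt_pi (by positivity) ?_
    rw [← hθn]
    have : ((i : ℕ) : ℝ) < n := by exact_mod_cast i.2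
    exact mul_lt_mul_of_pos_right (by linarith) hθ0
  · ext i
    simp only [Matrix.mulVec, dotProduct, eccMatrix_compl_pathGraph_apply hn, add_mul, ite_mul,
      zero_mul, Finset.sum_add_distrib, Pi.smul_apply, smul_eq_mul]
    have h1 : (∑ j : Fin n, if (i : ℕ) + 1 = j then 2 * Real.sin (((j : ℕ) : ℝ) * θ + 1 * θ) else 0) =
        2 * Real.sin (((i : ℕ) + 2 : ℝ) * θ) := by
      rw [Fin.sum_univ_eq_sum_range
        (fun j => if (i : ℕ) + 1 = j then 2 * Real.sin ((j : ℝ) * θ + 1 * θ) else 0),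
        Finset.sum_ite_eq]
      split_ifs with h
      · push_cast; congr 2; ring
      · have h' : (i : ℕ) + 1 = n := by
          have := i.2
          rw [Finset.mem_range] at h
          omega
        have h'' : ((i : ℕ) : ℝ) + 1 = n := by exact_mod_cast h'
        rw [show ((i : ℕ) : ℝ) + 2 = n + 1 by linarith, hθn, Real.sin_pi, mul_zero]
    have h2 : (∑ j : Fin n, if (j : ℕ) + 1 = i then 2 * Real.sin (((j : ℕ) : ℝ) * θ + 1 * θ) else 0) =
        2 * Real.sin (((i : ℕ) : ℝ) * θ) := by
      rcases Nat.eq_zero_or_pos (i : ℕ) with h | h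
      · simp [h]
      · obtain ⟨k, hk⟩ := Nat.exists_eq_add_of_le' h
        rw [Fin.sum_univ_eq_sum_range
          (fun j => if j + 1 = (i : ℕ) then 2 * Real.sin ((j : ℝ) * θ + 1 * θ) else 0)]
        simp only [hk, Nat.add_right_cancel_iff]
        rw [Finset.sum_ite_eq', if_pos (by have := i.2; rw [Finset.mem_range]; omega)]
        push_cast; congr 2; ring
    rw [h1, h2, ← mul_add, Real.sin_add_sin]
    rw [show (((i : ℕ) + 2 : ℝ) * θ + ((i : ℕ) : ℝ) * θ) / 2 = ((i : ℕ) : ℝ) * θ + 1 * θ by ring,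
      show (((i : ℕ) + 2 : ℝ) * θ - ((i : ℕ) : ℝ) * θ) / 2 = θ by ring]
    ring

theorem eccSpectralRadius_compl_pathGraph_four : (pathGraph 4)ᶜ.eccSpectralRadius = 4 := by
  have hs := isSparse_pathGraph le_rfl
  refine (eccMatrix_isHermitian _).eq_of_isGreatest_spectrum_of_pos
    hs.eccMatrix_compl_nonneg (isGreatest_eccSpectralRadius _)
    -- The middle edge carries entry 3 and the outer edges 2; the inner rows give `2 * 1 + 3 * 2 = 4
    -- * 2`.
    (x := ![1, 2, 2, 1]) (fun i => ?_) ?_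
  · fin_cases i <;> simp
  · ext i
    simp only [Matrix.mulVec, dotProduct, Fin.sum_univ_four, hs.eccMatrix_compl_apply,
      pathGraph_adj, Fin.forall_fin_succ]
    fin_cases i <;> simp <;> norm_num

/-- A tree on four vertices with connected complement is a path. -/
theorem IsTree.nonempty_iso_pathGraph_four {V : Type*} [Fintype V] {T : SimpleGraph V}
    (hT : T.IsTree) (hcard : Fintype.card V = 4) (hs : T.IsSparse) :
    Nonempty (T ≃g pathGraph 4) := by
  obtain ⟨σ, p, hσ, hσn, hp⟩ := hT.connected.exists_numbering
  refine hT.nonempty_iso_pathGraph hcard hσ (fun v => hcard ▸ hσn v) (fun v hv => (hp v hv).1)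
    fun v hv => ?_
  -- Failure is only possible with `σ v = 3` and `σ (p v) = 0`. Then `p v` is adjacent to all other
  -- vertices, contradicting its neighbour in the complement.
  by_contra hne
  have hle := (hp v hv).2
  have hvn := hσn v
  obtain ⟨w, hw⟩ := hs.exists_compl_adj (p v)
  rw [compl_adj] at hw
  have hw0 : σ w ≠ σ (p v) := fun h => hw.1 (hσ h).symm
  have hwn := hσn w
  have hw1 : σ w ≤ 2 ∨ w = v := by
    by_cases h : σ w = σ v
    · exact Or.inr (hσ h)
    · left; omega
  rcases hw1 with hw1 | rfl
  · have h1 := hp w (by omega)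
    have h2 : p w = p v := hσ (by omega)
    exact hw.2 (h2 ▸ h1.1.symm)
  · exact hw.2 (hp w hv).1.symm

theorem IsTree.four_mul_cos_le_eccSpectralRadius_compl {V : Type*} [Fintype V] [DecidableEq V]
    {T : SimpleGraph V} (hT : T.IsTree) (hs : T.IsSparse) {n : ℕ} (hn : 2 ≤ n)
    (hcard : Fintype.card V = n) :
    4 * Real.cos (Real.pi / ((n : ℝ) + 1)) ≤ Tᶜ.eccSpectralRadius ∧
      (Tᶜ.eccSpectralRadius = 4 * Real.cos (Real.pi / ((n : ℝ) + 1)) →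
        Nonempty (T ≃g pathGraph n)) := by
  subst hcard
  have := hT.connected.nonempty
  obtain ⟨σ, p, hσ, hσn, hp⟩ := hT.connected.exists_numbering
  have hMp : ∀ v, 0 < σ v → 2 ≤ Tᶜ.eccMatrix v (p v) := fun v hv =>
    hs.two_le_eccMatrix_compl (hp v hv).1
  have hp' : ∀ v, 0 < σ v → σ (p v) ≤ σ v - 2 := fun v hv => (hp v hv).2
  have hH := eccMatrix_isHermitian Tᶜ
  let x : V → ℝ := fun v => zigzagSin (Fintype.card V) (σ v)
  have hx0 : x ≠ 0 := fun h =>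
    (zigzagSin_pos (hσn (Classical.arbitrary V))).ne' (congrFun h (Classical.arbitrary V))
  obtain ⟨h1, h2⟩ := hH.le_of_isGreatest_spectrum (isGreatest_eccSpectralRadius Tᶜ) hx0
    (two_mul_cos_mul_dotProduct_zigzagSin_le hn hH hs.eccMatrix_compl_nonneg hσ hσn hp' hMp rfl)
  refine ⟨h1, fun h => hT.nonempty_iso_pathGraph rfl hσ hσn (fun v hv => (hp v hv).1)
    (eq_sub_two_of_mulVec_zigzagSin_eq hH hs.eccMatrix_compl_nonneg hσ hσn hp' hMp rfl (h2 h))⟩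

end SimpleGraph

theorem mainTheorem1 {V : Type*} [Fintype V] [DecidableEq V] (n : ℕ) (hn : 4 ≤ n)
    (T : SimpleGraph V) (hcard : Fintype.card V = n) (hT : T.IsTree) (hTc : Tᶜ.Connected) :
    ((SimpleGraph.pathGraph n)ᶜ.Connected ∧
      (5 ≤ n → (SimpleGraph.pathGraph n)ᶜ.eccSpectralRadius
        = 4 * Real.cos (Real.pi / ((n : ℝ) + 1))) ∧
      (n = 4 → (SimpleGraph.pathGraph n)ᶜ.eccSpectralRadius = 4)) ∧
    (SimpleGraph.pathGraph n)ᶜ.eccSpectralRadius ≤ Tᶜ.eccSpectralRadius ∧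
    (Tᶜ.eccSpectralRadius = (SimpleGraph.pathGraph n)ᶜ.eccSpectralRadius ↔
      Nonempty (T ≃g SimpleGraph.pathGraph n)) := by
  have : NeZero n := ⟨by omega⟩
  have : Nontrivial V := Fintype.one_lt_card_iff_nontrivial.1 (by omega)
  have hs := hT.isSparse hTc
  have hP := SimpleGraph.isSparse_pathGraph hn
  have hiso : Nonempty (T ≃g SimpleGraph.pathGraph n) →
      Tᶜ.eccSpectralRadius = (SimpleGraph.pathGraph n)ᶜ.eccSpectralRadius :=
    fun ⟨φ⟩ => φ.eccSpectralRadius_compl_eq hs hP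
  refine ⟨⟨hP.compl_connected, SimpleGraph.eccSpectralRadius_compl_pathGraph, ?_⟩, ?_⟩
  · rintro rfl
    exact SimpleGraph.eccSpectralRadius_compl_pathGraph_four
  · rcases hn.eq_or_lt with rfl | h5
    · have h := hT.nonempty_iso_pathGraph_four hcard hs
      exact ⟨(hiso h).ge, fun _ => h, hiso⟩
    · obtain ⟨h1, h2⟩ := hT.four_mul_cos_le_eccSpectralRadius_compl hs (by omega) hcard
      rw [← SimpleGraph.eccSpectralRadius_compl_pathGraph h5] at h1 h2
      exact ⟨h1, h2, hiso⟩
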